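/- Notation. Let $\varphi=(1+\sqrt5)/2$, let $\{x\}=x-\lfloor x\rfloor$, and let $F_0=0$, $F_1=1$, $F_i=F_{i-1}+F_{i-2}$. Let $f(0)f(1)f(2)\cdots=01001010\cdots$ be the Fibonacci word, i.e. the limit of the words $X_0=1$, $X_1=0$, $X_n=X_{n-1}X_{n-2}$. For $x,y\in[0,1)$ put $[x,y)\bmod 1=[x,y)$ if $x<y$ and $[x,y)\bmod 1=[x,1)\cup[0,y)$ if $x\ge y$. For $n\ge0$ with Zeckendorf representation $n=\sum_{i\ge2}a_iF_i$ and $a\in\{0,1\}$, let $n^{(a)}=\sum_{i\ge2}a_iF_{i+1}+aF_2$ (append the digit $a$). A Fibonacci DFAO is a finite deterministic automaton with output over the input alphabet $\{0,1\}$; it generates a sequence $(a(i))_{i\ge0}$ with msd-first input if, for every word without two consecutive $1$s that represents $i$ in the Zeckendorf system (most significant digit first, any number of leading zeros), it reaches a state with output $a(i)$, while words that contain two consecutive $1$s reach no state (transitions may be undefined). For an integer $r\le-1$ let $R\ge2$ be minimal with $F_R\ge -r$, and write $r=-F_R+\sum_{i\ge2}b_iF_i$, where $\sum_{i\ge2}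 b_iF_i$ is the Zeckendorf representation of $F_R+r$. Let $r'=-F_{R-1}+\sum_{i\ge3}b_iF_{i-1}$ (drop the last digit), $r_0=r$, $r_k=(r_{k-1})'$, and $E(r)=\{\{r_k\varphi\}:0\le k\le R-2\}$. Theorem. There is a constant $C$ such that the following holds for every integer $c\ge0$. Let $\mathcal P_c$ be the set of intervals modulo $1$ into which $[0,1)$ is cut by the points of $E(-(c+1))\cup E(-(c+2))$, i.e. the intervals $[x,y)\bmod 1$ with $x,y$ among these points that contain none of these points other than $x$. Then: 1. $\mathcal P_c$ is a partition of $[0,1)$. 2. $\mathcal P_c$ is consistent with appending digits: for every $I\in\mathcal P_c$ there are $I_0,I_1\in\mathcal P_c$ such that for all integers $n\ge0$ with $\{n\varphi\}\in I$ we have $\{n^{(0)}\varphi\}\in I_0$ and, if $f(n)\ne1$, also $\{n^{(1)}\varphi\}\in I_1$. 3. There is a Fibonacci DFAO with (finite) state set $\mathcal P_c$ that generates $(f(i+c))_{i\ge0}$ with msd-first input. Its initial state is the interval that contains $0$, and whenever $\{n\varphi\}\in I$ and $a=0$ or $f(n)=0$, the transition from $I$ on $a$ is defined and leads to the interval that contains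 $\{n^{(a)}\varphi\}$. 4. If $c\ge2$, then the number of states satisfies $|\mathcal P_c|\le C\log c$. -/

import Mathlib

/-- The finite Fibonacci words over `{0,1}`: `X₀ = 1`, `X₁ = 0`, `Xₙ = Xₙ₋₁ Xₙ₋₂`. -/
def finiteFibWord : ℕ → List (Fin 2)
  | 0 => [1]
  | 1 => [0]
  | n + 2 => finiteFibWord (n + 1) ++ finiteFibWord n

/-- The infinite Fibonacci word `f = 01001010⋯`, the limit of the words `Xₙ`
(see `finiteFibWord_getElem?`). -/
def fibWord (i : ℕ) : Fin 2 := (finiteFibWord (i + 2)).getD i 0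

theorem length_finiteFibWord (n : ℕ) : (finiteFibWord n).length = Nat.fib (n + 1) := by
  induction n using finiteFibWord.induct with
  | case1 => rfl
  | case2 => rfl
  | case3 n h1 h2 =>
    rw [finiteFibWord, List.length_append, h1, h2, Nat.fib_add_two (n := n + 1)]
    ring

/-- The definition of `f` as a limit makes sense: from `X_{i+2}` on, all the words `Xₙ` have the
letter `f i` at position `i`. -/
theorem finiteFibWord_getElem? (i n : ℕ) (h : i + 2 ≤ n) :
    (finiteFibWord n)[i]? = some (fibWord i) := by
  have hlen : ∀ m, i + 2 ≤ m → i < (finiteFibWord m).length := by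
    intro m hm
    rw [length_finiteFibWord]
    have h1 : i + 2 < Nat.fib (i + 3) + 2 := by
      have := Nat.le_fib_add_one (i + 3)
      omega
    have h2 : Nat.fib (i + 3) ≤ Nat.fib (m + 1) := Nat.fib_mono (by omega)
    omega
  induction n, h using Nat.le_induction with
  | base =>
    have := hlen (i + 2) le_rfl
    rw [List.getElem?_eq_getElem this]
    simp [fibWord, List.getD_eq_getElem?_getD, List.getElem?_eq_getElem this]
  | succ n hn ih =>
    obtain ⟨m, rfl⟩ : ∃ m, n = m + 1 := ⟨n - 1, by omega⟩
    rw [finiteFibWord, List.getElem?_append_left (hlen _ hn), ih]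

/-- The value `[x]_F = ∑ xᵢ F_{i+2}` of a word `x = x_{ℓ-1} ⋯ x₀` written with its most
significant digit first. -/
def fibValue : List (Fin 2) → ℕ
  | [] => 0
  | a :: w => (a : ℕ) * Nat.fib (w.length + 2) + fibValue w

/-- A word is a valid Zeckendorf representation (possibly with leading zeros) if it does not
contain two consecutive `1`s. -/
def IsZeckendorfWord (w : List (Fin 2)) : Prop :=
  w.IsChain fun a b => ¬ (a = 1 ∧ b = 1)

/-- A deterministic finite automaton with output, with state set `Q`, input alphabet `A` and
output alphabet `Δ`. The transition function may be undefined (`none`) at some arguments. -/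
structure DFAO (Q A Δ : Type*) where
  finite_states : Finite Q
  step : Q → A → Option Q
  start : Q
  out : Q → Δ

/-- The state (if any) that is reached from the initial state by reading a word from left to
right. -/
def DFAO.run {Q A Δ : Type*} (M : DFAO Q A Δ) (w : List A) : Option Q :=
  w.foldlM M.step M.start

/-- `M` is a Fibonacci DFAO that generates the sequence `a` with msd-first input: on every valid
Zeckendorf representation of `i`, with any number of leading zeros, the output is `a i`, and inputs
with two consecutive `1`s do not reach any state. -/
def DFAO.GeneratesMsd {Q Δ : Type*} (M : DFAO Q (Fin 2) Δ) (a : ℕ → Δ) : Prop :=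
  ∀ w : List (Fin 2),
    (IsZeckendorfWord w → ∃ q, M.run w = some q ∧ M.out q = a (fibValue w)) ∧
    (¬ IsZeckendorfWord w → M.run w = none)

/-- `n^{(a)}`: append the digit `a` at the right end of the Zeckendorf expansion of `n`, so that
each `F_i` becomes `F_{i+1}`, and `a F₂` is added. -/
def appendDigit (n : ℕ) (a : Fin 2) : ℕ :=
  ((Nat.zeckendorf n).map fun i => Nat.fib (i + 1)).sum + (a : ℕ) * Nat.fib 2

theorem exists_le_fib (n : ℕ) : ∃ k, 2 ≤ k ∧ n ≤ Nat.fib k :=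
  ⟨n + 2, by omega, by
    have := Nat.le_fib_add_one (n + 2)
    omega⟩

/-- For a negative integer `r`, the index `R ≥ 2` of the smallest Fibonacci number `F_R ≥ -r`,
that is, of the leading term of the negative Zeckendorf representation
`r = -F_R + ∑_{2 ≤ i ≤ R-3} b_i F_i`. -/
def negIndex (r : ℤ) : ℕ := Nat.find (exists_le_fib r.natAbs)

/-- For a negative integer `r`, the indices `i ≥ 2` of the other terms of its negative Zeckendorf
representation, which form the Zeckendorf representation of `F_R + r`. -/
def negTail (r : ℤ) : List ℕ := Nat.zeckendorf (Nat.fib (negIndex r) - r.natAbs)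

/-- `r'` for a negative integer `r = -F_R + ∑_{i ≥ 2} b_i F_i`: drop the rightmost digit, which
gives `-F_{R-1} + ∑_{i ≥ 3} b_i F_{i-1}`. -/
def negDrop (r : ℤ) : ℤ :=
  -(Nat.fib (negIndex r - 1) : ℤ) +
    ((((negTail r).filter fun i => 3 ≤ i).map fun i => Nat.fib (i - 1)).sum : ℕ)

/-- The points `{r_k φ}` for `0 ≤ k ≤ R - 2`, where `r_0 = r` and `r_k = (r_{k-1})'`. -/
noncomputable def truncationPoints (r : ℤ) : Set ℝ :=
  {x | ∃ k ≤ negIndex r - 2, x = Int.fract (((negDrop^[k] r : ℤ) : ℝ) * Real.goldenRatio)}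

/-- For `x, y ∈ [0,1)`, the half-open interval `[x, y) mod 1` (all of `[0,1)` if `x = y`). -/
def modIco (x y : ℝ) : Set ℝ :=
  {t | (x < y ∧ x ≤ t ∧ t < y) ∨ (y ≤ x ∧ ((x ≤ t ∧ t < 1) ∨ (0 ≤ t ∧ t < y)))}

/-- The set of intervals modulo 1 into which a set `E` of points of `[0,1)` cuts `[0,1)`: the
intervals `[x, y) mod 1` with `x, y ∈ E` that contain no point of `E` other than `x`. -/
def intervalsOf (E : Set ℝ) : Set (Set ℝ) :=
  {I | ∃ x ∈ E, ∃ y ∈ E, I = modIco x y ∧ ∀ z ∈ E, z ∈ modIco x y → z = x}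

/-- `P` is a partition of the set `S`. -/
def IsPartitionOf (P : Set (Set ℝ)) (S : Set ℝ) : Prop :=
  (∀ I ∈ P, I.Nonempty) ∧ (∀ I ∈ P, ∀ J ∈ P, I ≠ J → Disjoint I J) ∧ ⋃₀ P = S

/-- Consistency of `P` with the msd-first Fibonacci representation. -/
def ConsistentMsd (P : Set (Set ℝ)) : Prop :=
  ∀ I ∈ P, ∃ I₀ ∈ P, ∃ I₁ ∈ P, ∀ n : ℕ, Int.fract ((n : ℝ) * Real.goldenRatio) ∈ I →
    Int.fract ((appendDigit n 0 : ℝ) * Real.goldenRatio) ∈ I₀ ∧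
    (fibWord n ≠ 1 → Int.fract ((appendDigit n 1 : ℝ) * Real.goldenRatio) ∈ I₁)

/-- The partition of `[0,1)` whose endpoints are the points `{r_k φ}` obtained from
`r = -(c+1)` together with those obtained from `r = -(c+2)`. -/
noncomputable def msdPartition (c : ℕ) : Set (Set ℝ) :=
  intervalsOf (truncationPoints (-((c : ℤ) + 1)) ∪ truncationPoints (-((c : ℤ) + 2)))

/-! Write `ψ` for `Real.goldenConj`, so that `ψ ^ 2 = ψ + 1`. Since `F_i φ = F_{i+1} - ψ ^ i`, the
Zeckendorf digits of `n` express `n φ` modulo 1 as a polynomial in `ψ`, and appending a digit `a`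
acts by the decreasing affine map `x ↦ ψ x - a ψ ^ 2`. No reduction modulo 1 is needed if points are
represented in the window `[ψ, ψ + 1)`, whose left end is the point of `-1` (`wordPoint_mem`,
`rotPoint_appendDigit`). The letter `f n` is the last digit of `n`; it is 1 exactly on the arc from
the point of `-1` to that of `-2` (`fibWord_eq_one_iff`).

A negative number `-F_R + [w]` is governed by the same maps, started at the right end `ψ + 1` of the
window. Truncations correspond to prefixes of `w`, so the cut of `v ++ [b]` is the image of the cut
of `v` under the map of `b`. The images for the digits 0 and 1 lie on opposite sides of `2 ψ + 1`.
Hence, after a digit is appended, comparison with the cut of `v ++ [b]` is either decided by the two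
digits or equivalent to a comparison with the cut of `v` beforehand
(`rotPoint_negValue_le_appendDigit_iff`). A prefix-closed set of cuts that contains `[0]` is
therefore consistent (`Unseparated.appendDigit`).

Rotating back by `c` steps turns the arc for the letter 1 into the arc from `-(c+1)` to `-(c+2)`.
Both ends are cuts, so `f (n + c)` is constant on intervals (`Unseparated.fibWord_add_eq`). The
number of cuts is at most linear in the lengths of the two representations, hence logarithmic in
`c`. -/

/-! ### Intervals modulo 1 -/

/-- The representative of `t ∈ [0,1)` modulo `1` in the window `[p - 1, p)`. -/
noncomputable def window (p t : ℝ) : ℝ := if t < p then t else t - 1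

/-- The points of `[0,1)` whose nearest point of `E` to the left, in the window that ends at `p`,
is `x`. -/
def arcFrom (p : ℝ) (E : Set ℝ) (x : ℝ) : Set ℝ :=
  {t | t ∈ Set.Ico (0 : ℝ) 1 ∧ window p x ≤ window p t ∧
    ∀ z ∈ E, window p z ≤ window p t → window p z ≤ window p x}

theorem window_injOn {p : ℝ} {s t : ℝ} (hs : s ∈ Set.Ico (0 : ℝ) 1) (ht : t ∈ Set.Ico (0 : ℝ) 1)
    (h : window p s = window p t) : s = t := by
  obtain ⟨hs0, hs1⟩ := hs
  obtain ⟨ht0, ht1⟩ := ht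
  unfold window at h
  split_ifs at h <;> linarith

theorem window_self_le {p t : ℝ} (hp : p ∈ Set.Ico (0 : ℝ) 1) (ht : t ∈ Set.Ico (0 : ℝ) 1) :
    window p p ≤ window p t := by
  obtain ⟨hp0, hp1⟩ := hp
  obtain ⟨ht0, ht1⟩ := ht
  unfold window
  split_ifs <;> linarith

/-- Unrolling the circle at `p` turns an arc that does not cross `p` into an ordinary interval. As a
right end, `p` stands for the top of the window, although `window p p` is its bottom; hence the
separate case `y = p`. -/
theorem mem_modIco_iff_window {p x y t : ℝ} (hp : p ∈ Set.Ico (0 : ℝ) 1)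
    (hx : x ∈ Set.Ico (0 : ℝ) 1) (hy : y ∈ Set.Ico (0 : ℝ) 1)
    (hxy : y = p ∨ window p x < window p y) :
    t ∈ modIco x y ↔
      t ∈ Set.Ico (0 : ℝ) 1 ∧ window p x ≤ window p t ∧ (y = p ∨ window p t < window p y) := by
  simp only [modIco, window, Set.mem_ofPred_eq, Set.mem_Ico] at *
  grind

theorem cut_mem_modIco {p x y : ℝ} (hp : p ∈ Set.Ico (0 : ℝ) 1)
    (hx : x ∈ Set.Ico (0 : ℝ) 1) (hy : y ∈ Set.Ico (0 : ℝ) 1) (hyp : y ≠ p)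
    (hxy : window p y ≤ window p x) : p ∈ modIco x y := by
  simp only [modIco, window, Set.mem_ofPred_eq, Set.mem_Ico] at *
  grind

theorem intervalsOf_eq_image_arcFrom {p : ℝ} {E : Set ℝ} (hE : E ⊆ Set.Ico 0 1)
    (hfin : E.Finite) (hpE : p ∈ E) : intervalsOf E = arcFrom p E '' E := by
  have hp := hE hpE
  ext I
  constructor
  · rintro ⟨x, hx, y, hy, rfl, hI⟩
    refine ⟨x, hx, ?_⟩
    have hxy : y = p ∨ window p x < window p y := by
      by_contra! h
      -- An arc that wraps past the cut contains `p`, which forces `p = x`; then `y` lies at or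
      -- below the bottom of the window, so `y = p` after all.
      have hpx := hI p hpE (cut_mem_modIco hp (hE hx) (hE hy) h.1 h.2)
      subst hpx
      exact h.1 (window_injOn (hE hy) (hE hx) (le_antisymm h.2 (window_self_le hp (hE hy))))
    ext t
    rw [mem_modIco_iff_window hp (hE hx) (hE hy) hxy]
    constructor
    · rintro ⟨ht, h1, h2⟩
      refine ⟨ht, h1, ?_⟩
      by_contra! h
      exact absurd (h2 y hy h.2) (not_le.2 (hxy.resolve_left h.1))
    · rintro ⟨ht, h1, h2⟩
      refine ⟨ht, h1, fun z hz hzt => ?_⟩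
      by_contra! h
      have := hI z hz ((mem_modIco_iff_window hp (hE hx) (hE hy) hxy).2
        ⟨hE hz, h.le, h2.imp_right fun h2 => hzt.trans_lt h2⟩)
      subst this
      exact lt_irrefl _ h
  · rintro ⟨x, hx, rfl⟩
    obtain ⟨y, hy, hxy, hmin⟩ : ∃ y ∈ E, (y = p ∨ window p x < window p y) ∧
        ∀ z ∈ E, window p x < window p z → y ≠ p ∧ window p y ≤ window p z := by
      by_cases hne : {z ∈ E | window p x < window p z}.Nonempty
      · obtain ⟨y, ⟨hy, hxy⟩, hmin⟩ := Set.exists_min_image _ (window p)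
          (hfin.subset (Set.sep_subset _ _)) hne
        refine ⟨y, hy, Or.inr hxy, fun z hz hxz => ⟨?_, hmin z ⟨hz, hxz⟩⟩⟩
        rintro rfl
        exact absurd hxy (not_lt.2 (window_self_le hp (hE hx)))
      · refine ⟨p, hpE, Or.inl rfl, fun z hz hxz => (hne ⟨z, hz, hxz⟩).elim⟩
    have harc : arcFrom p E x = modIco x y := by
      ext t
      rw [mem_modIco_iff_window hp (hE hx) (hE hy) hxy]
      constructor
      · rintro ⟨ht, h1, h2⟩
        refine ⟨ht, h1, hxy.imp_right fun hxy => ?_⟩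
        by_contra! h
        exact absurd (h2 y hy h) (not_le.2 hxy)
      · rintro ⟨ht, h1, h2⟩
        refine ⟨ht, h1, fun z hz hzt => ?_⟩
        by_contra! h
        obtain ⟨h3, h4⟩ := hmin z hz h
        exact absurd (h2.resolve_left h3) (not_lt.2 (h4.trans hzt))
    refine ⟨x, hx, y, hy, harc, fun z hz hzI => ?_⟩
    rw [← harc] at hzI
    exact window_injOn (hE hz) (hE hx) (le_antisymm (hzI.2.2 z hz le_rfl) hzI.2.1)

theorem isPartitionOf_intervalsOf {E : Set ℝ} (hE : E ⊆ Set.Ico 0 1) (hfin : E.Finite)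
    (hne : E.Nonempty) : IsPartitionOf (intervalsOf E) (Set.Ico 0 1) := by
  obtain ⟨p, hpE⟩ := hne
  rw [intervalsOf_eq_image_arcFrom hE hfin hpE]
  refine ⟨?_, ?_, ?_⟩
  · rintro _ ⟨x, hx, rfl⟩
    exact ⟨x, hE hx, le_rfl, fun z _ hz => hz⟩
  · rintro _ ⟨x, hx, rfl⟩ _ ⟨y, hy, rfl⟩ hxy
    rw [Set.disjoint_left]
    rintro t ⟨-, h1, h2⟩ ⟨-, h3, h4⟩
    exact hxy (by rw [window_injOn (hE hx) (hE hy) (le_antisymm (h4 x hx h1) (h2 y hy h3))])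
  · ext t
    constructor
    · rintro ⟨_, ⟨x, hx, rfl⟩, ht⟩
      exact ht.1
    · intro ht
      obtain ⟨x, ⟨hx, hxt⟩, hmax⟩ := Set.exists_max_image {z ∈ E | window p z ≤ window p t}
        (window p) (hfin.subset (Set.sep_subset _ _)) ⟨p, hpE, window_self_le (hE hpE) ht⟩
      exact ⟨_, ⟨x, hx, rfl⟩, ht, hxt, fun z hz hzt => hmax z ⟨hz, hzt⟩⟩

theorem ncard_intervalsOf_le {E : Set ℝ} (hE : E ⊆ Set.Ico 0 1) (hfin : E.Finite)
    (hne : E.Nonempty) : (intervalsOf E).Finite ∧ Nat.card (intervalsOf E) ≤ E.ncard := by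
  obtain ⟨p, hpE⟩ := hne
  rw [intervalsOf_eq_image_arcFrom hE hfin hpE]
  exact ⟨hfin.image _, Set.ncard_image_le hfin⟩

/-- Two points of `[0,1)` are in the same interval if and only if no point of `E` separates them. -/
theorem mem_intervalsOf_iff_of_mem {p : ℝ} {E : Set ℝ} (hE : E ⊆ Set.Ico 0 1) (hfin : E.Finite)
    (hpE : p ∈ E) {I : Set ℝ} (hI : I ∈ intervalsOf E) {s t : ℝ} (hs : s ∈ I)
    (ht : t ∈ Set.Ico (0 : ℝ) 1) :
    t ∈ I ↔ ∀ z ∈ E, window p z ≤ window p s ↔ window p z ≤ window p t := by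
  rw [intervalsOf_eq_image_arcFrom hE hfin hpE] at hI
  obtain ⟨x, hx, rfl⟩ := hI
  obtain ⟨-, h1, h2⟩ := hs
  constructor
  · rintro ⟨-, h3, h4⟩ z hz
    exact ⟨fun h => (h2 z hz h).trans h3, fun h => (h4 z hz h).trans h1⟩
  · intro h
    exact ⟨ht, (h x hx).1 h1, fun z hz hzt => h2 z hz ((h z hz).2 hzt)⟩

/-! ### Zeckendorf words -/

/-- The indices `i` of the Fibonacci numbers `F_i` that occur in `fibValue w`. -/
def fibIndices : List (Fin 2) → List ℕ
  | [] => []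
  | a :: w => if a = 1 then (w.length + 2) :: fibIndices w else fibIndices w

theorem sum_map_fib_fibIndices (w : List (Fin 2)) :
    ((fibIndices w).map Nat.fib).sum = fibValue w := by
  induction w with
  | nil => rfl
  | cons a w ih =>
    fin_cases a
    · simpa [fibIndices, fibValue] using ih
    · simpa [fibIndices, fibValue] using ih

theorem isZeckendorfWord_append {v w : List (Fin 2)} : IsZeckendorfWord (v ++ w) ↔
    IsZeckendorfWord v ∧ IsZeckendorfWord w ∧
      ¬ (v.getLast? = some 1 ∧ w.head? = some 1) := by
  simp only [IsZeckendorfWord, List.isChain_append, Option.mem_def]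
  refine and_congr_right fun _ => and_congr_right fun _ => ⟨fun h h' => ?_, fun h x hx y hy h' => ?_⟩
  · exact h 1 h'.1 1 h'.2 ⟨rfl, rfl⟩
  · exact h ⟨by rw [hx, h'.1], by rw [hy, h'.2]⟩

theorem isZeckendorfWord_concat {v : List (Fin 2)} {a : Fin 2} : IsZeckendorfWord (v ++ [a]) ↔
    IsZeckendorfWord v ∧ ¬ (v.getLast? = some 1 ∧ a = 1) := by
  rw [isZeckendorfWord_append]
  simp [IsZeckendorfWord]

theorem isZeckendorfWord_cons {v : List (Fin 2)} {a : Fin 2} : IsZeckendorfWord (a :: v) ↔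
    IsZeckendorfWord v ∧ ¬ (a = 1 ∧ v.head? = some 1) := by
  have := isZeckendorfWord_append (v := [a]) (w := v)
  simp only [List.singleton_append] at this
  rw [this]
  simp [IsZeckendorfWord]

/-- The bound on the largest index is what the induction needs: after a leading 1 the next digit is
0, which leaves the gap of two. The sentinel `0` is the one in `List.IsZeckendorfRep`. -/
theorem isZeckendorfRep_fibIndices {w : List (Fin 2)} (hw : IsZeckendorfWord w) :
    (fibIndices w).IsZeckendorfRep ∧
      ∀ i ∈ (fibIndices w ++ [0]).head?, i < w.length + (if w.head? = some 1 then 2 else 1) := by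
  induction w with
  | nil => simp [fibIndices, List.IsZeckendorfRep]
  | cons a w ih =>
    rw [isZeckendorfWord_cons] at hw
    obtain ⟨h1, h2⟩ := ih hw.1
    have ha : a = 0 ∨ a = 1 := by omega
    rcases ha with rfl | rfl
    · refine ⟨by simpa [fibIndices] using h1, fun i hi => ?_⟩
      have := h2 i (by simpa [fibIndices] using hi)
      simp only [List.length_cons]
      split_ifs at * <;> omega
    · simp only [true_and] at hw
      simp only [hw.2, if_false] at h2
      refine ⟨?_, fun i hi => ?_⟩
      · simp only [fibIndices, if_true, List.IsZeckendorfRep, List.cons_append]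
        refine List.IsChain.cons h1 fun i hi => ?_
        have := h2 i hi
        omega
      · obtain rfl : w.length + 2 = i := by simpa [fibIndices] using hi
        simp

theorem zeckendorf_fibValue {w : List (Fin 2)} (hw : IsZeckendorfWord w) :
    Nat.zeckendorf (fibValue w) = fibIndices w := by
  rw [← sum_map_fib_fibIndices, Nat.zeckendorf_sum_fib (isZeckendorfRep_fibIndices hw).1]

theorem fibValue_lt {w : List (Fin 2)} (hw : IsZeckendorfWord w) :
    fibValue w < Nat.fib (w.length + 2) := by
  rw [← sum_map_fib_fibIndices]
  obtain ⟨h1, h2⟩ := isZeckendorfRep_fibIndices hw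
  refine h1.sum_fib_lt fun i hi => (h2 i hi).trans_le ?_
  split_ifs <;> omega

theorem exists_word (l n : ℕ) (hn : n < Nat.fib (l + 2)) :
    ∃ w : List (Fin 2), w.length = l ∧ IsZeckendorfWord w ∧ fibValue w = n := by
  induction l using Nat.strong_induction_on generalizing n with
  | _ l ih =>
    match l with
    | 0 => exact ⟨[], rfl, by simp [IsZeckendorfWord], by simp at hn; simp [fibValue, hn]⟩
    | l + 1 =>
      by_cases h : n < Nat.fib (l + 2)
      · obtain ⟨w, h1, h2, h3⟩ := ih l (by omega) n h
        exact ⟨0 :: w, by simp [h1], by simp [isZeckendorfWord_cons, h2], by simp [fibValue, h3]⟩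
      · have h5 := Nat.fib_add_two (n := l + 1)
        match l with
        | 0 =>
          refine ⟨[1], rfl, by simp [IsZeckendorfWord], ?_⟩
          simp [fibValue, Nat.fib_add_two] at *
          omega
        | l + 1 =>
          obtain ⟨w, h1, h2, h3⟩ := ih l (by omega) (n - Nat.fib (l + 3)) (by
            simp only [add_assoc, Nat.reduceAdd] at *; omega)
          refine ⟨1 :: 0 :: w, by simp [h1], by simp [isZeckendorfWord_cons, h2], ?_⟩
          simp [fibValue, h3, h1]
          simp only [add_assoc, Nat.reduceAdd] at *
          omega

theorem exists_word_fibValue_eq (n : ℕ) :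
    ∃ w : List (Fin 2), IsZeckendorfWord w ∧ fibValue w = n := by
  obtain ⟨w, -, h⟩ := exists_word n n (by have := Nat.le_fib_add_one (n + 2); omega)
  exact ⟨w, h⟩

theorem fibIndices_concat (w : List (Fin 2)) (a : Fin 2) :
    fibIndices (w ++ [a]) = (fibIndices w).map (· + 1) ++ if a = 1 then [2] else [] := by
  induction w with
  | nil => simp [fibIndices]
  | cons b w ih =>
    simp only [List.cons_append, fibIndices, ih]
    split_ifs <;> simp [add_right_comm]

theorem two_le_of_mem_fibIndices {w : List (Fin 2)} {i : ℕ} (hi : i ∈ fibIndices w) : 2 ≤ i := by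
  induction w with
  | nil => simp [fibIndices] at hi
  | cons b w ih =>
    simp only [fibIndices] at hi
    split_ifs at hi
    · grind
    · exact ih hi

theorem fibValue_concat (w : List (Fin 2)) (a : Fin 2) :
    fibValue (w ++ [a]) = ((fibIndices w).map fun i => Nat.fib (i + 1)).sum + (a : ℕ) := by
  rw [← sum_map_fib_fibIndices, fibIndices_concat]
  have ha : a = 0 ∨ a = 1 := by omega
  rcases ha with rfl | rfl <;> simp [Function.comp_def]

theorem appendDigit_fibValue {w : List (Fin 2)} (hw : IsZeckendorfWord w) (a : Fin 2) :
    appendDigit (fibValue w) a = fibValue (w ++ [a]) := by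
  simp [appendDigit, zeckendorf_fibValue hw, fibValue_concat]

/-! ### Letters of the Fibonacci word as last Zeckendorf digits -/

/-- In `X_{k+3} = X_{k+2} X_{k+1}` the first factor has length `F_{k+3}`, so this position is
position `m` of the second factor, itself a prefix of `f`. -/
theorem fibWord_fib_add {k m : ℕ} (hm : m < Nat.fib (k + 2)) :
    fibWord (Nat.fib (k + 3) + m) = fibWord m := by
  have key : ∀ {j i}, i < Nat.fib (j + 2) → (finiteFibWord (j + 1))[i]? = some (fibWord i) := by
    intro j i hi
    have hpre : ∀ n, j + 1 ≤ n → (finiteFibWord n)[i]? = (finiteFibWord (j + 1))[i]? := by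
      intro n hn
      induction n, hn using Nat.le_induction with
      | base => rfl
      | succ n hn ih =>
        obtain ⟨n, rfl⟩ : ∃ l, n = l + 1 := ⟨n - 1, by omega⟩
        rw [finiteFibWord, List.getElem?_append_left, ih]
        rw [length_finiteFibWord]
        exact hi.trans_le (Nat.fib_mono (by omega))
    rw [← hpre (i + j + 2) (by omega), finiteFibWord_getElem? i _ (by omega)]
  have h1 := key (j := k + 2) (i := Nat.fib (k + 3) + m) (by
    rw [Nat.fib_add_two (n := k + 2)]; simp only [add_assoc, Nat.reduceAdd] at *; omega)
  rw [finiteFibWord, List.getElem?_append_right (by rw [length_finiteFibWord]; simp),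
    length_finiteFibWord, Nat.add_sub_cancel_left, key hm] at h1
  exact (Option.some.inj h1).symm

/-- Removing the leading digit leaves the letter unchanged, by `fibWord_fib_add`; the 0 that must
follow a leading 1 makes the remainder small enough. -/
theorem fibWord_fibValue {w : List (Fin 2)} (hw : IsZeckendorfWord w) :
    fibWord (fibValue w) = 1 ↔ w.getLast? = some 1 := by
  induction w with
  | nil => simp [fibValue, fibWord, finiteFibWord]
  | cons a w ih =>
    rw [isZeckendorfWord_cons] at hw
    have ih := ih hw.1
    have ha : a = 0 ∨ a = 1 := by omega
    rcases ha with rfl | rfl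
    · simp only [fibValue, Fin.val_zero, zero_mul, zero_add, ih]
      cases w <;> simp
    · match w with
      | [] => simp [fibValue, fibWord, finiteFibWord]
      | b :: w =>
        have hb : b = 0 := by simp at hw; omega
        subst hb
        have := fibValue_lt ((isZeckendorfWord_cons.1 hw.1).1)
        rw [fibValue, Fin.val_one, one_mul, List.length_cons, fibWord_fib_add, ih]
        · simp
        · simpa [fibValue] using this

/-! ### Negative Zeckendorf representations -/

/-- The negative integer `-F_{ℓ+2} + [w]_F`, where `ℓ` is the length of `w`. -/
def negValue (w : List (Fin 2)) : ℤ := -(Nat.fib (w.length + 2) : ℤ) + (fibValue w : ℤ)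

/-- The word `w` consists of the digits below the leading one in a negative Zeckendorf
representation: the first two of them are `0`. -/
def IsNegZeckendorfWord (w : List (Fin 2)) : Prop :=
  IsZeckendorfWord w ∧ ∀ a ∈ w.take 2, a = 0

theorem IsNegZeckendorfWord.of_prefix {v w : List (Fin 2)} (hw : IsNegZeckendorfWord w)
    (h : v <+: w) : IsNegZeckendorfWord v := by
  obtain ⟨u, rfl⟩ := h
  refine ⟨(isZeckendorfWord_append.1 hw.1).1, fun a ha => hw.2 a ?_⟩
  rw [List.take_append]
  exact List.mem_append_left _ ha

theorem IsNegZeckendorfWord.fibValue_lt {w : List (Fin 2)} (hw : IsNegZeckendorfWord w)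
    (h : w ≠ []) : fibValue w < Nat.fib w.length := by
  match w with
  | [a] =>
    obtain rfl : a = 0 := hw.2 a (by simp)
    simp [fibValue]
  | a :: b :: w =>
    obtain rfl : a = 0 := hw.2 a (by simp)
    obtain rfl : b = 0 := hw.2 b (by simp)
    have := _root_.fibValue_lt (isZeckendorfWord_cons.1 (isZeckendorfWord_cons.1 hw.1).1).1
    simpa [fibValue] using this

theorem IsNegZeckendorfWord.fibValue_lt_fib_add_two {w : List (Fin 2)}
    (hw : IsNegZeckendorfWord w) : fibValue w < Nat.fib (w.length + 2) :=
  _root_.fibValue_lt hw.1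

theorem IsNegZeckendorfWord.natAbs_negValue {w : List (Fin 2)} (hw : IsNegZeckendorfWord w) :
    (negValue w).natAbs = Nat.fib (w.length + 2) - fibValue w := by
  have := hw.fibValue_lt_fib_add_two
  unfold negValue
  omega

theorem IsNegZeckendorfWord.negIndex_negValue {w : List (Fin 2)} (hw : IsNegZeckendorfWord w) :
    negIndex (negValue w) = w.length + 2 := by
  rw [negIndex, Nat.find_eq_iff, hw.natAbs_negValue]
  refine ⟨⟨by omega, by omega⟩, fun n hn h => ?_⟩
  by_cases h0 : w = []
  · subst h0
    simp at hn
    omega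
  · have h1 := hw.fibValue_lt h0
    have h2 : Nat.fib n ≤ Nat.fib (w.length + 1) := Nat.fib_mono (by omega)
    have h3 := Nat.fib_add_two (n := w.length)
    omega

theorem IsNegZeckendorfWord.negTail_negValue {w : List (Fin 2)} (hw : IsNegZeckendorfWord w) :
    negTail (negValue w) = fibIndices w := by
  rw [negTail, hw.negIndex_negValue, hw.natAbs_negValue,
    Nat.sub_sub_self hw.fibValue_lt_fib_add_two.le, zeckendorf_fibValue hw.1]

theorem IsNegZeckendorfWord.negDrop_negValue {v : List (Fin 2)} {a : Fin 2}
    (hw : IsNegZeckendorfWord (v ++ [a])) : negDrop (negValue (v ++ [a])) = negValue v := by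
  rw [negDrop, hw.negIndex_negValue, hw.negTail_negValue, negValue, fibIndices_concat,
    ← sum_map_fib_fibIndices v]
  have h1 : ((fibIndices v).map (· + 1)).filter (fun i => 3 ≤ i) = (fibIndices v).map (· + 1) := by
    rw [List.filter_eq_self]
    intro i hi
    obtain ⟨j, hj, rfl⟩ := List.mem_map.1 hi
    have := two_le_of_mem_fibIndices hj
    simpa using this
  have h2 : (if a = 1 then [2] else []).filter (fun i => 3 ≤ i) = [] := by
    split_ifs <;> simp
  rw [List.filter_append, h1, h2]
  simp [Function.comp_def]

theorem IsNegZeckendorfWord.negDrop_iterate_negValue {w : List (Fin 2)}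
    (hw : IsNegZeckendorfWord w) (k : ℕ) (hk : k ≤ w.length) :
    negDrop^[k] (negValue w) = negValue (w.take (w.length - k)) := by
  induction k with
  | zero => simp
  | succ k ih =>
    rw [Function.iterate_succ_apply', ih (by omega)]
    obtain ⟨j, hj⟩ : ∃ j, w.length - k = j + 1 := ⟨w.length - k - 1, by omega⟩
    have hj' : w.length - (k + 1) = j := by omega
    have h := hw.of_prefix (List.take_prefix (j + 1) w)
    rw [hj, hj']
    rw [← List.take_concat_get' w j (by omega)] at h ⊢
    exact h.negDrop_negValue

theorem IsNegZeckendorfWord.truncationPoints_negValue {w : List (Fin 2)}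
    (hw : IsNegZeckendorfWord w) : truncationPoints (negValue w) =
      {x | ∃ v, v <+: w ∧ x = Int.fract ((negValue v : ℝ) * Real.goldenRatio)} := by
  ext x
  simp only [truncationPoints, hw.negIndex_negValue, Nat.add_sub_cancel, Set.mem_ofPred_eq]
  constructor
  · rintro ⟨k, hk, rfl⟩
    exact ⟨_, List.take_prefix _ _, by rw [hw.negDrop_iterate_negValue k hk]⟩
  · rintro ⟨v, hv, rfl⟩
    refine ⟨w.length - v.length, by omega, ?_⟩
    rw [hw.negDrop_iterate_negValue _ (by omega), Nat.sub_sub_self hv.length_le,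
      ← List.prefix_iff_eq_take.1 hv]

/-- Minimality of `R` gives `F_R - s < F_R - F_{R-1} = F_{R-2}`, hence the two leading zeros. The
bound on `s` later yields the logarithmic length. -/
theorem exists_negValue_eq (s : ℕ) (hs : 1 ≤ s) :
    ∃ w, IsNegZeckendorfWord w ∧ negValue w = -(s : ℤ) ∧ Nat.fib (w.length + 1) ≤ s ∧
      (2 ≤ s → w ≠ []) := by
  obtain ⟨h1, h2⟩ := Nat.find_spec (exists_le_fib s)
  have h3 : ∀ m, 2 ≤ m → m < Nat.find (exists_le_fib s) → Nat.fib m < s := fun m hm h => by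
    have := Nat.find_min (exists_le_fib s) h
    omega
  generalize Nat.find (exists_le_fib s) = R at *
  match R with
  | 2 =>
    simp at h2
    obtain rfl : s = 1 := by omega
    exact ⟨[], by simp [IsNegZeckendorfWord, IsZeckendorfWord], by simp [negValue, fibValue],
      by simp, by omega⟩
  | 3 =>
    have := h3 2 le_rfl (by omega)
    have h4 : Nat.fib 3 = 2 := rfl
    simp at this
    obtain rfl : s = 2 := by omega
    exact ⟨[0], by simp [IsNegZeckendorfWord, IsZeckendorfWord],
      by simp [negValue, fibValue, h4], by simp, by simp⟩
  | l + 4 =>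
    have h4 := h3 (l + 3) (by omega) (by omega)
    have h5 : Nat.fib (l + 4) = Nat.fib (l + 2) + Nat.fib (l + 3) := Nat.fib_add_two
    obtain ⟨v, rfl, h6, h7⟩ := exists_word l (Nat.fib (l + 4) - s) (by omega)
    refine ⟨0 :: 0 :: v, ⟨?_, ?_⟩, ?_, ?_, ?_⟩
    · simp [isZeckendorfWord_cons, h6]
    · simp
    · simp only [negValue, List.length_cons, fibValue, h7, add_assoc, Nat.reduceAdd]
      simp
      omega
    · simpa using h4.le
    · simp

/-! ### The rotation by the golden ratio -/

open Real in
theorem goldenConj_sq_eq : goldenConj * goldenConj = goldenConj + 1 := by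
  rw [← sq, goldenConj_sq]

theorem goldenConj_lt_neg_half : Real.goldenConj < -1 / 2 := by
  nlinarith [goldenConj_sq_eq, Real.goldenConj_neg, Real.neg_one_lt_goldenConj]

/-- The representative of `m φ` modulo `1` in the window `[ψ, ψ + 1)`. -/
noncomputable def rotPoint (m : ℤ) : ℝ :=
  window (Real.goldenConj + 1) (Int.fract ((m : ℝ) * Real.goldenRatio))

theorem fract_mem_Ico (x : ℝ) : Int.fract x ∈ Set.Ico (0 : ℝ) 1 :=
  ⟨Int.fract_nonneg x, Int.fract_lt_one x⟩

theorem eq_of_mul_goldenRatio_eq {m n k : ℤ}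
    (h : (m : ℝ) * Real.goldenRatio = n * Real.goldenRatio + k) : m = n := by
  by_contra hmn
  have : Irrational (((m - n : ℤ) : ℝ) * Real.goldenRatio) :=
    Real.goldenRatio_irrational.intCast_mul (sub_ne_zero.2 hmn)
  refine this.ne_int k ?_
  push_cast
  linarith

theorem rotPoint_spec (m : ℤ) : Real.goldenConj ≤ rotPoint m ∧ rotPoint m < Real.goldenConj + 1 ∧
    ∃ k : ℤ, (m : ℝ) * Real.goldenRatio = rotPoint m + k := by
  have h1 := Int.fract_nonneg ((m : ℝ) * Real.goldenRatio)
  have h2 := Int.fract_lt_one ((m : ℝ) * Real.goldenRatio)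
  have h3 := Int.floor_add_fract ((m : ℝ) * Real.goldenRatio)
  have h4 := Real.goldenConj_neg
  have h5 := Real.neg_one_lt_goldenConj
  unfold rotPoint window
  split_ifs with h
  · exact ⟨by linarith, h, ⌊(m : ℝ) * Real.goldenRatio⌋, by linarith⟩
  · exact ⟨by linarith, by linarith, ⌊(m : ℝ) * Real.goldenRatio⌋ + 1, by push_cast; linarith⟩

theorem rotPoint_eq {m : ℤ} {x : ℝ} {k : ℤ} (h1 : Real.goldenConj ≤ x)
    (h2 : x < Real.goldenConj + 1) (h : (m : ℝ) * Real.goldenRatio = x + k) : rotPoint m = x := by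
  obtain ⟨h3, h4, l, hl⟩ := rotPoint_spec m
  have h5 : ((l - k : ℤ) : ℝ) < (1 : ℤ) := by push_cast; linarith
  have h6 : ((-1 : ℤ) : ℝ) < ((l - k : ℤ) : ℝ) := by push_cast; linarith
  have h7 : l = k := by
    have := Int.cast_lt.1 h5
    have := Int.cast_lt.1 h6
    omega
  subst h7
  linarith

theorem rotPoint_injective : Function.Injective rotPoint := by
  intro m n h
  obtain ⟨-, -, k, hk⟩ := rotPoint_spec m
  obtain ⟨-, -, l, hl⟩ := rotPoint_spec n
  refine eq_of_mul_goldenRatio_eq (k := k - l) ?_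
  push_cast
  linarith

theorem rotPoint_neg_one : rotPoint (-1) = Real.goldenConj :=
  rotPoint_eq (k := -1) le_rfl (by linarith)
    (by push_cast; linarith [Real.goldenRatio_add_goldenConj])

theorem rotPoint_neg_two : rotPoint (-2) = 2 * Real.goldenConj + 1 :=
  rotPoint_eq (k := -3) (by linarith [Real.neg_one_lt_goldenConj])
    (by linarith [Real.goldenConj_neg])
    (by push_cast; linarith [Real.goldenRatio_add_goldenConj])

/-- By irrationality of `φ`, only `m = -1` can hit the ends of the window modulo 1, so closed bounds
suffice for all other `m`. -/
theorem rotPoint_eq_of_le {m : ℤ} {x : ℝ} {k : ℤ} (hm : m ≠ -1) (h1 : Real.goldenConj ≤ x)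
    (h2 : x ≤ Real.goldenConj + 1) (h : (m : ℝ) * Real.goldenRatio = x + k) : rotPoint m = x := by
  refine rotPoint_eq h1 (h2.lt_of_ne ?_) h
  rintro rfl
  refine hm (eq_of_mul_goldenRatio_eq (k := k + 2) ?_)
  push_cast
  linarith [Real.goldenRatio_add_goldenConj]

/-! ### Appending digits as affine maps -/

/-- The effect of appending the digit `a` on the point `n φ` modulo `1`. -/
noncomputable def digitMap (x : ℝ) (a : Fin 2) : ℝ :=
  Real.goldenConj * x - (a : ℕ) * (Real.goldenConj + 1)

/-- The effect of appending all the digits of `w`, starting from `x`. -/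
noncomputable def wordPoint (x : ℝ) (w : List (Fin 2)) : ℝ := w.foldl digitMap x

theorem wordPoint_concat (x : ℝ) (w : List (Fin 2)) (a : Fin 2) :
    wordPoint x (w ++ [a]) = digitMap (wordPoint x w) a := by
  simp [wordPoint]

theorem wordPoint_eq_add (x : ℝ) (w : List (Fin 2)) :
    wordPoint x w = Real.goldenConj ^ w.length * x + wordPoint 0 w := by
  induction w generalizing x with
  | nil => simp [wordPoint]
  | cons a w ih =>
    have h : ∀ y, wordPoint y (a :: w) = wordPoint (digitMap y a) w := fun _ => rfl
    rw [h, h, ih (digitMap x a), ih (digitMap 0 a)]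
    simp only [digitMap, List.length_cons]
    ring

theorem fib_mul_goldenRatio (k : ℕ) :
    (Nat.fib k : ℝ) * Real.goldenRatio = Nat.fib (k + 1) - Real.goldenConj ^ k := by
  linarith [Real.fib_succ_sub_goldenRatio_mul_fib k]

theorem fibValue_mul_goldenRatio (w : List (Fin 2)) :
    ∃ k : ℤ, (fibValue w : ℝ) * Real.goldenRatio = wordPoint 0 w + k := by
  induction w with
  | nil => exact ⟨0, by simp [fibValue, wordPoint]⟩
  | cons a w ih =>
    obtain ⟨k, hk⟩ := ih
    have h : wordPoint 0 (a :: w) = wordPoint (digitMap 0 a) w := rfl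
    refine ⟨k + (a : ℕ) * Nat.fib (w.length + 3), ?_⟩
    rw [h, wordPoint_eq_add, fibValue]
    push_cast
    rw [add_mul, mul_assoc, fib_mul_goldenRatio, hk, digitMap, pow_add, Real.goldenConj_sq]
    ring

theorem negValue_mul_goldenRatio (w : List (Fin 2)) :
    ∃ k : ℤ, (negValue w : ℝ) * Real.goldenRatio = wordPoint (Real.goldenConj + 1) w + k := by
  obtain ⟨k, hk⟩ := fibValue_mul_goldenRatio w
  refine ⟨k - Nat.fib (w.length + 3), ?_⟩
  rw [wordPoint_eq_add, negValue]
  push_cast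
  rw [add_mul, neg_mul, fib_mul_goldenRatio, hk, pow_add, Real.goldenConj_sq]
  ring

theorem wordPoint_mem {x : ℝ} (hx1 : 2 * Real.goldenConj + 1 ≤ x) (hx2 : x ≤ Real.goldenConj + 1)
    {w : List (Fin 2)} (hw : IsZeckendorfWord w) :
    Real.goldenConj ≤ wordPoint x w ∧ wordPoint x w ≤ Real.goldenConj + 1 ∧
      (w.getLast? = some 1 → wordPoint x w ≤ 2 * Real.goldenConj + 1) ∧
      (w.getLast? ≠ some 1 → 2 * Real.goldenConj + 1 ≤ wordPoint x w) := by
  have h0 := Real.goldenConj_neg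
  have h1 := Real.neg_one_lt_goldenConj
  have h2 := goldenConj_sq_eq
  induction w using List.reverseRecOn with
  | nil => simp [wordPoint]; exact ⟨by linarith, hx2, hx1⟩
  | append_singleton w a ih =>
    rw [isZeckendorfWord_concat] at hw
    obtain ⟨h3, h4, h5, h6⟩ := ih hw.1
    rw [wordPoint_concat]
    have ha : a = 0 ∨ a = 1 := by omega
    rcases ha with rfl | rfl
    · simp only [digitMap, Fin.val_zero, Nat.cast_zero, List.getLast?_concat]
      have h7 := mul_le_mul_of_nonpos_left h3 h0.le
      have h8 := mul_le_mul_of_nonpos_left h4 h0.le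
      refine ⟨by linarith, by linarith, by simp, fun _ => by linarith⟩
    · have h7 := mul_le_mul_of_nonpos_left (h6 (by simpa using hw.2)) h0.le
      have h8 := mul_le_mul_of_nonpos_left h4 h0.le
      simp only [digitMap, Fin.val_one, Nat.cast_one, List.getLast?_concat]
      exact ⟨by linarith, by linarith, fun _ => by linarith, by simp⟩

theorem rotPoint_fibValue {w : List (Fin 2)} (hw : IsZeckendorfWord w) :
    rotPoint (fibValue w) = wordPoint 0 w := by
  obtain ⟨k, hk⟩ := fibValue_mul_goldenRatio w
  have h := wordPoint_mem (x := 0) (by linarith [goldenConj_lt_neg_half])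
    (by linarith [Real.neg_one_lt_goldenConj]) hw
  exact rotPoint_eq_of_le (by omega) h.1 h.2.1 (by exact_mod_cast hk)

theorem IsNegZeckendorfWord.wordPoint_mem {w : List (Fin 2)} (hw : IsNegZeckendorfWord w) :
    Real.goldenConj ≤ wordPoint (Real.goldenConj + 1) w ∧
      wordPoint (Real.goldenConj + 1) w ≤ Real.goldenConj + 1 ∧
      (w.getLast? ≠ some 1 → 2 * Real.goldenConj + 1 ≤ wordPoint (Real.goldenConj + 1) w) := by
  have h := _root_.wordPoint_mem (x := Real.goldenConj + 1) (by linarith [Real.goldenConj_neg])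
    le_rfl hw.1
  exact ⟨h.1, h.2.1, h.2.2.2⟩

theorem IsNegZeckendorfWord.negValue_ne_neg_one {w : List (Fin 2)} (hw : IsNegZeckendorfWord w)
    (h : w ≠ []) : negValue w ≠ -1 := by
  have h1 := hw.fibValue_lt h
  have h2 := Nat.fib_add_two (n := w.length)
  have h3 : 0 < Nat.fib (w.length + 1) := Nat.fib_pos.2 (by omega)
  unfold negValue
  omega

theorem IsNegZeckendorfWord.rotPoint_negValue {w : List (Fin 2)} (hw : IsNegZeckendorfWord w)
    (h : w ≠ []) : rotPoint (negValue w) = wordPoint (Real.goldenConj + 1) w := by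
  obtain ⟨k, hk⟩ := negValue_mul_goldenRatio w
  exact rotPoint_eq_of_le (hw.negValue_ne_neg_one h) hw.wordPoint_mem.1 hw.wordPoint_mem.2.1 hk

theorem IsNegZeckendorfWord.negValue_neg {w : List (Fin 2)} (hw : IsNegZeckendorfWord w) :
    negValue w < 0 := by
  have := hw.fibValue_lt_fib_add_two
  unfold negValue
  omega

theorem fibWord_eq_one_iff (n : ℕ) : fibWord n = 1 ↔ ¬ rotPoint (-2) ≤ rotPoint n := by
  obtain ⟨w, hw, rfl⟩ := exists_word_fibValue_eq n
  have h := wordPoint_mem (x := 0) (by linarith [goldenConj_lt_neg_half])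
    (by linarith [Real.neg_one_lt_goldenConj]) hw
  rw [fibWord_fibValue hw]
  constructor
  · intro hl
    have h1 : rotPoint (fibValue w) ≠ rotPoint (-2) := fun he => by
      have := rotPoint_injective he
      omega
    rw [not_le]
    refine lt_of_le_of_ne ?_ h1
    rw [rotPoint_fibValue hw, rotPoint_neg_two]
    exact h.2.2.1 hl
  · intro hl
    by_contra hne
    rw [rotPoint_fibValue hw, rotPoint_neg_two] at hl
    exact hl (h.2.2.2 hne)

theorem rotPoint_appendDigit {n : ℕ} {a : Fin 2} (h : a = 0 ∨ fibWord n = 0) :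
    rotPoint (appendDigit n a) = digitMap (rotPoint n) a := by
  obtain ⟨w, hw, rfl⟩ := exists_word_fibValue_eq n
  have hwa : IsZeckendorfWord (w ++ [a]) := by
    rw [isZeckendorfWord_concat, ← fibWord_fibValue hw]
    refine ⟨hw, fun h' => ?_⟩
    rcases h with h | h
    · exact absurd (h.symm.trans h'.2) (by decide)
    · exact absurd (h.symm.trans h'.1) (by decide)
  rw [appendDigit_fibValue hw, rotPoint_fibValue hwa, rotPoint_fibValue hw, wordPoint_concat]

/-! ### Integers that are not separated by truncation points -/

/-- No point `{[v] φ}` with `v ∈ W` separates `m φ` from `n φ` modulo `1`. -/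
def Unseparated (W : Set (List (Fin 2))) (m n : ℤ) : Prop :=
  ∀ v ∈ W, rotPoint (negValue v) ≤ rotPoint m ↔ rotPoint (negValue v) ≤ rotPoint n

theorem negValue_nil : negValue [] = -1 := by simp [negValue, fibValue]

theorem negValue_zero : negValue [0] = -2 := by
  have h : Nat.fib 3 = 2 := rfl
  simp [negValue, fibValue, h]

theorem Unseparated.fibWord_eq {W : Set (List (Fin 2))} (hW : [0] ∈ W) {m n : ℕ}
    (h : Unseparated W m n) : fibWord m = fibWord n := by
  have h1 := h _ hW
  rw [negValue_zero] at h1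
  have h2 := fibWord_eq_one_iff m
  have h3 := fibWord_eq_one_iff n
  have h4 : fibWord m = 1 ↔ fibWord n = 1 := by rw [h2, h3, h1]
  omega

/-- For equal digits, both points are images under one decreasing map, which flips the comparison
with the parent cut `v`. For different digits, the point `2ψ + 1` separates the images. -/
theorem rotPoint_negValue_le_appendDigit_iff {v : List (Fin 2)} {b : Fin 2}
    (hv : IsNegZeckendorfWord (v ++ [b])) {n : ℕ} {a : Fin 2} (h : a = 0 ∨ fibWord n = 0) :
    rotPoint (negValue (v ++ [b])) ≤ rotPoint (appendDigit n a) ↔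
      a = b ∧ (v = [] ∨ ¬ rotPoint (negValue v) ≤ rotPoint n) ∨ a = 0 ∧ b = 1 := by
  have hψ := Real.goldenConj_neg
  have hψ' := goldenConj_sq_eq
  obtain ⟨h1, h2, -⟩ := rotPoint_spec n
  have hv' := hv.of_prefix (List.prefix_append v [b])
  obtain ⟨h3, h4, h5⟩ := hv'.wordPoint_mem
  have ha : a = 0 ∨ a = 1 := by omega
  have hb : b = 0 ∨ b = 1 := by omega
  have key : digitMap (wordPoint (Real.goldenConj + 1) v) a ≤ digitMap (rotPoint n) a ↔
      v = [] ∨ ¬ rotPoint (negValue v) ≤ rotPoint n := by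
    have : digitMap (wordPoint (Real.goldenConj + 1) v) a ≤ digitMap (rotPoint n) a ↔
        rotPoint n ≤ wordPoint (Real.goldenConj + 1) v := by
      simp only [digitMap, sub_le_sub_iff_right]
      exact mul_le_mul_left_of_neg hψ
    rw [this]
    -- The empty word starts at the right end `ψ + 1`, whereas `rotPoint (-1)` is the left end `ψ`;
    -- this is why `v = []` is a separate alternative.
    by_cases hn : v = []
    · subst hn
      simpa [wordPoint] using h2.le
    · rw [hv'.rotPoint_negValue hn, or_iff_right hn, not_le]
      refine ⟨fun h => h.lt_of_ne ?_, le_of_lt⟩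
      rw [← hv'.rotPoint_negValue hn]
      intro he
      have := rotPoint_injective he
      have := hv'.negValue_neg
      omega
  by_cases hab : a = b
  · subst hab
    rw [hv.rotPoint_negValue (by simp), wordPoint_concat, rotPoint_appendDigit h, key]
    have : ¬ (a = 0 ∧ a = 1) := by omega
    simp [this]
  · rw [hv.rotPoint_negValue (by simp), wordPoint_concat, rotPoint_appendDigit h]
    rcases ha with rfl | rfl
    · obtain rfl : b = 1 := by omega
      have h6 := h5 (by simpa using (isZeckendorfWord_concat.1 hv.1).2)
      have h7 := mul_le_mul_of_nonpos_left h6 hψ.le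
      have h8 := mul_le_mul_of_nonpos_left h2.le hψ.le
      simp only [digitMap, Fin.val_one, Nat.cast_one, Fin.val_zero, Nat.cast_zero]
      simp
      linarith
    · obtain rfl : b = 0 := by omega
      have h6 : rotPoint (-2) ≤ rotPoint n := by
        by_contra h6
        rw [← fibWord_eq_one_iff] at h6
        simp [h6] at h
      have h7 : rotPoint (-2) ≠ rotPoint n := fun he => by
        have := rotPoint_injective he
        omega
      have h8 := h6.lt_of_ne h7
      rw [rotPoint_neg_two] at h8
      have h9 := mul_lt_mul_of_neg_left h8 hψ
      have h10 := mul_le_mul_of_nonpos_left h4 hψ.le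
      simp only [digitMap, Fin.val_one, Nat.cast_one, Fin.val_zero, Nat.cast_zero]
      simp
      linarith

theorem Unseparated.appendDigit {W : Set (List (Fin 2))} (hW : ∀ v ∈ W, IsNegZeckendorfWord v)
    (hW' : ∀ v a, v ++ [a] ∈ W → v ∈ W) (hW0 : [0] ∈ W) {m n : ℕ} (h : Unseparated W m n)
    {a : Fin 2} (ha : a = 0 ∨ fibWord m = 0) :
    Unseparated W (appendDigit m a) (appendDigit n a) := by
  have ha' : a = 0 ∨ fibWord n = 0 := h.fibWord_eq hW0 ▸ ha
  intro v hv
  rcases List.eq_nil_or_concat' v with rfl | ⟨v, b, rfl⟩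
  · simp only [negValue_nil, rotPoint_neg_one, (rotPoint_spec _).1]
  · rw [rotPoint_negValue_le_appendDigit_iff (hW _ hv) ha,
      rotPoint_negValue_le_appendDigit_iff (hW _ hv) ha', h v (hW' v b hv)]

/-! ### Letters of the shifted word -/

theorem rotPoint_sub_one (m : ℤ) :
    rotPoint (m - 1) = rotPoint m + Real.goldenConj + if rotPoint m < 0 then 1 else 0 := by
  have h0 := Real.goldenConj_neg
  have h3 := goldenConj_lt_neg_half
  have h4 := Real.neg_one_lt_goldenConj
  obtain ⟨h1, h2, k, hk⟩ := rotPoint_spec m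
  have h5 := Real.goldenRatio_add_goldenConj
  split_ifs with h
  · exact rotPoint_eq (k := k - 2) (by linarith) (by linarith) (by push_cast; linarith)
  · exact rotPoint_eq (k := k - 1) (by linarith) (by linarith) (by push_cast; linarith)

theorem rotPoint_sub_sub_one (m n : ℤ) : rotPoint (n - m - 1) =
    rotPoint n - rotPoint m + Real.goldenConj + if rotPoint m ≤ rotPoint n then 0 else 1 := by
  obtain ⟨h1, h2, k, hk⟩ := rotPoint_spec m
  obtain ⟨h3, h4, l, hl⟩ := rotPoint_spec n
  have h5 := Real.goldenRatio_add_goldenConj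
  split_ifs with h
  · exact rotPoint_eq (k := l - k - 1) (by linarith) (by linarith) (by push_cast; linarith)
  · exact rotPoint_eq (k := l - k - 2) (by linarith) (by linarith) (by push_cast; linarith)

/-- The arc of length `ψ + 1` from the point of `-(c+1)` to that of `-(c+2)` stays inside the window
exactly when it starts below 0; otherwise it wraps around, and the conjunction becomes a
disjunction. -/
theorem fibWord_add_eq_one_iff (n c : ℕ) : fibWord (n + c) = 1 ↔
    if rotPoint (-((c : ℤ) + 1)) < 0 then
      rotPoint (-((c : ℤ) + 1)) ≤ rotPoint n ∧ ¬ rotPoint (-((c : ℤ) + 2)) ≤ rotPoint n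
    else rotPoint (-((c : ℤ) + 1)) ≤ rotPoint n ∨ ¬ rotPoint (-((c : ℤ) + 2)) ≤ rotPoint n := by
  rw [fibWord_eq_one_iff, rotPoint_neg_two]
  have h1 := rotPoint_sub_sub_one (-((c : ℤ) + 1)) n
  have h2 := rotPoint_sub_one (-((c : ℤ) + 1))
  rw [show -((c : ℤ) + 1) - 1 = -(c + 2) by ring] at h2
  rw [show (n : ℤ) - -((c : ℤ) + 1) - 1 = ((n + c : ℕ) : ℤ) by push_cast; ring] at h1
  rw [h1, h2]
  obtain ⟨h3, h4, -⟩ := rotPoint_spec n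
  obtain ⟨h5, h6, -⟩ := rotPoint_spec (-((c : ℤ) + 1))
  have h7 := Real.goldenConj_neg
  generalize rotPoint n = x at *
  generalize rotPoint (-((c : ℤ) + 1)) = y at *
  split_ifs with h8 h9 h9
  · simp only [h8, true_and, not_le]
    constructor <;> intro h <;> linarith
  · simp only [h8, true_or, iff_true, not_le]
    linarith
  · simp only [h8, false_and, iff_false, not_le, not_lt]
    linarith
  · simp only [h8, false_or, not_le]
    constructor <;> intro h <;> linarith

theorem Unseparated.fibWord_add_eq {W : Set (List (Fin 2))} {c : ℕ} {v w : List (Fin 2)}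
    (hv : v ∈ W) (hv' : negValue v = -((c : ℤ) + 1)) (hw : w ∈ W)
    (hw' : negValue w = -((c : ℤ) + 2)) {m n : ℕ} (h : Unseparated W m n) :
    fibWord (m + c) = fibWord (n + c) := by
  have h1 := h v hv
  have h2 := h w hw
  rw [hv'] at h1
  rw [hw'] at h2
  have h3 : fibWord (m + c) = 1 ↔ fibWord (n + c) = 1 := by
    rw [fibWord_add_eq_one_iff, fibWord_add_eq_one_iff, h1, h2]
  omega

/-- The points `{[v] φ}` with `v ∈ W`. -/
noncomputable def cutPoints (W : Set (List (Fin 2))) : Set ℝ :=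
  (fun v => Int.fract ((negValue v : ℝ) * Real.goldenRatio)) '' W

theorem cutPoints_subset (W : Set (List (Fin 2))) : cutPoints W ⊆ Set.Ico 0 1 := by
  rintro _ ⟨v, -, rfl⟩
  exact fract_mem_Ico _

theorem goldenConj_add_one_mem_cutPoints {W : Set (List (Fin 2))} (hW : [] ∈ W) :
    Real.goldenConj + 1 ∈ cutPoints W := by
  refine ⟨[], hW, ?_⟩
  dsimp only
  rw [negValue_nil, Int.fract_eq_iff]
  refine ⟨by linarith [Real.neg_one_lt_goldenConj], by linarith [Real.goldenConj_neg], -2, ?_⟩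
  push_cast
  linarith [Real.goldenRatio_add_goldenConj]

theorem fract_mem_interval_iff {W : Set (List (Fin 2))} (hfin : W.Finite) (hW : [] ∈ W)
    {I : Set ℝ} (hI : I ∈ intervalsOf (cutPoints W)) {m n : ℕ}
    (hm : Int.fract ((m : ℝ) * Real.goldenRatio) ∈ I) :
    Int.fract ((n : ℝ) * Real.goldenRatio) ∈ I ↔ Unseparated W m n := by
  rw [mem_intervalsOf_iff_of_mem (cutPoints_subset W) (hfin.image _)
    (goldenConj_add_one_mem_cutPoints hW) hI hm (fract_mem_Ico _)]
  simp [cutPoints, Unseparated, rotPoint]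

/-! ### The automaton -/

theorem DFAO.run_concat {Q A Δ : Type*} (M : DFAO Q A Δ) (w : List A) (a : A) :
    M.run (w ++ [a]) = (M.run w).bind fun q => M.step q a := by
  simp [DFAO.run, List.foldlM_append]

/-- An automaton on a finite set of states, each of which stands for a set of natural numbers
that behaves uniformly under appending digits. -/
theorem exists_dfao_generatesMsd {Q : Type*} [Finite Q] (mem : ℕ → Q → Prop) (s : ℕ → Fin 2)
    (hex : ∀ n, ∃ q, mem n q)
    (happ : ∀ q m n a, mem m q → mem n q → (a = 0 ∨ fibWord m = 0) → ∀ r,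
      mem (appendDigit m a) r → mem (appendDigit n a) r)
    (hfib : ∀ q m n, mem m q → mem n q → fibWord m = fibWord n)
    (hs : ∀ q m n, mem m q → mem n q → s m = s n) :
    ∃ M : DFAO Q (Fin 2) (Fin 2), mem 0 M.start ∧
      (∀ q n a, mem n q → (a = 0 ∨ fibWord n = 0) →
        ∃ r, M.step q a = some r ∧ mem (appendDigit n a) r) ∧
      M.GeneratesMsd s := by
  classical
  choose loc hloc using hex
  let M : DFAO Q (Fin 2) (Fin 2) :=
    { finite_states := inferInstance
      step := fun q a =>
        -- By `happ` the choice of representative does not matter. A state whose members all have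
        -- letter 1 has no transition on the digit 1, which rejects `11`.
        if h : ∃ n, mem n q ∧ (a = 0 ∨ fibWord n = 0) then some (loc (appendDigit h.choose a))
        else none
      start := loc 0
      out := fun q => if ∃ n, mem n q ∧ s n = 1 then 1 else 0 }
  have hstep : ∀ q n a, mem n q → (a = 0 ∨ fibWord n = 0) →
      ∃ r, M.step q a = some r ∧ mem (appendDigit n a) r := by
    intro q n a hn ha
    have h : ∃ n, mem n q ∧ (a = 0 ∨ fibWord n = 0) := ⟨n, hn, ha⟩
    exact ⟨loc (appendDigit h.choose a), dif_pos h,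
      happ q _ _ a h.choose_spec.1 hn h.choose_spec.2 _ (hloc _)⟩
  have hrun : ∀ w, IsZeckendorfWord w → ∃ q, M.run w = some q ∧ mem (fibValue w) q := by
    intro w
    induction w using List.reverseRecOn with
    | nil => exact fun _ => ⟨loc 0, rfl, hloc 0⟩
    | append_singleton w a ih =>
      intro hw
      rw [isZeckendorfWord_concat] at hw
      obtain ⟨q, h1, h2⟩ := ih hw.1
      obtain ⟨r, h3, h4⟩ := hstep q (fibValue w) a h2 (by
        have := fibWord_fibValue hw.1
        have h5 := hw.2
        rw [← this] at h5
        omega)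
      exact ⟨r, by rw [DFAO.run_concat, h1]; exact h3, by rwa [← appendDigit_fibValue hw.1]⟩
  refine ⟨M, hloc 0, hstep, fun w => ⟨fun hw => ?_, ?_⟩⟩
  · obtain ⟨q, h1, h2⟩ := hrun w hw
    refine ⟨q, h1, ?_⟩
    change (if ∃ n, mem n q ∧ s n = 1 then 1 else 0) = s (fibValue w)
    split_ifs with h
    · obtain ⟨n, h3, h4⟩ := h
      rw [← h4, hs q n _ h3 h2]
    · have : s (fibValue w) ≠ 1 := fun h3 => h ⟨_, h2, h3⟩
      omega
  · induction w using List.reverseRecOn with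
    | nil => exact fun h => (h (by simp [IsZeckendorfWord])).elim
    | append_singleton w a ih =>
      intro hw
      rw [isZeckendorfWord_concat] at hw
      rw [DFAO.run_concat]
      by_cases h : IsZeckendorfWord w
      · obtain ⟨q, h1, h2⟩ := hrun w h
        simp only [h, true_and, not_not] at hw
        obtain ⟨h3, rfl⟩ := hw
        rw [h1]
        refine dif_neg ?_
        rintro ⟨n, h4, h5⟩
        have h6 := hfib q _ _ h2 h4
        rw [(fibWord_fibValue h).2 h3] at h6
        omega
      · rw [ih h]
        rfl

theorem truncationPoints_union_eq {v w : List (Fin 2)} (hv : IsNegZeckendorfWord v)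
    (hw : IsNegZeckendorfWord w) :
    truncationPoints (negValue v) ∪ truncationPoints (negValue w) =
      cutPoints {u | u <+: v ∨ u <+: w} := by
  rw [hv.truncationPoints_negValue, hw.truncationPoints_negValue]
  ext x
  simp only [cutPoints, Set.mem_union, Set.mem_ofPred_eq, Set.mem_image]
  grind

theorem finite_prefixes_ncard_le (v w : List (Fin 2)) :
    {u | u <+: v ∨ u <+: w}.Finite ∧ {u | u <+: v ∨ u <+: w}.ncard ≤ v.length + w.length + 2 := by
  have h : {u | u <+: v ∨ u <+: w} = ((v.inits ++ w.inits).toFinset : Set (List (Fin 2))) := by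
    ext u
    simp
  rw [h]
  refine ⟨Finset.finite_toSet _, ?_⟩
  rw [Set.ncard_coe_finset]
  refine (List.toFinset_card_le _).trans ?_
  simp
  omega

/-! ### Logarithmic bound for the length of a representation -/

theorem goldenRatio_pow_le_fib (n : ℕ) : Real.goldenRatio ^ n ≤ Nat.fib (n + 2) := by
  induction n using Nat.twoStepInduction with
  | zero => simp
  | one =>
    have h : Nat.fib 3 = 2 := rfl
    simpa [h] using Real.goldenRatio_lt_two.le
  | more n h1 h2 =>
    have h3 := Real.goldenRatio_pow_sub_goldenRatio_pow n
    rw [Nat.fib_add_two (n := n + 2)]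
    push_cast
    linarith

theorem length_mul_log_goldenRatio_le {l s : ℕ} (hl : Nat.fib (l + 1) ≤ s) :
    (l : ℝ) * Real.log Real.goldenRatio ≤ Real.log Real.goldenRatio + Real.log s := by
  have h0 := Real.goldenRatio_pos
  match l with
  | 0 =>
    simp at hl
    have h1 := Real.log_nonneg Real.one_lt_goldenRatio.le
    have h2 := Real.log_nonneg (x := s) (by exact_mod_cast hl)
    simp
    linarith
  | l + 1 =>
    have h1 : Real.goldenRatio ^ l ≤ s := by
      have h2 := goldenRatio_pow_le_fib l
      exact h2.trans (by exact_mod_cast hl)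
    have h2 := Real.log_le_log (pow_pos h0 l) h1
    rw [Real.log_pow] at h2
    push_cast
    linarith

theorem theorem3 :
    ∃ C : ℝ, ∀ c : ℕ,
      IsPartitionOf (msdPartition c) (Set.Ico 0 1) ∧
      ConsistentMsd (msdPartition c) ∧
      (∃ M : DFAO (msdPartition c) (Fin 2) (Fin 2),
        (0 : ℝ) ∈ (M.start : Set ℝ) ∧
        (∀ (I : msdPartition c) (n : ℕ) (a : Fin 2),
          Int.fract ((n : ℝ) * Real.goldenRatio) ∈ (I : Set ℝ) → (a = 0 ∨ fibWord n = 0) →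
          ∃ J : msdPartition c, M.step I a = some J ∧
            Int.fract ((appendDigit n a : ℝ) * Real.goldenRatio) ∈ (J : Set ℝ)) ∧
        M.GeneratesMsd (fun i => fibWord (i + c))) ∧
      (2 ≤ c → (Nat.card (msdPartition c) : ℝ) ≤ C * Real.log c) := by
  -- Each of the two lengths is at most `1 + 2 log c / log φ`, and there are at most two more cuts
  -- than the sum of the lengths. The first summand of the constant absorbs the resulting 4, as `c ≥
  -- 2`.
  refine ⟨4 / Real.log 2 + 4 / Real.log Real.goldenRatio, fun c => ?_⟩
  obtain ⟨v, hv, hv', hvl, -⟩ := exists_negValue_eq (c + 1) (by omega)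
  obtain ⟨w, hw, hw', hwl, hw0⟩ := exists_negValue_eq (c + 2) (by omega)
  have hw0 := hw0 (by omega)
  push_cast at hv' hw'
  have hP : msdPartition c = intervalsOf (cutPoints {u | u <+: v ∨ u <+: w}) := by
    rw [msdPartition, ← hv', ← hw', truncationPoints_union_eq hv hw]
  obtain ⟨hfin, hcard⟩ := finite_prefixes_ncard_le v w
  have hWv : v ∈ {u | u <+: v ∨ u <+: w} := Or.inl List.prefix_rfl
  have hWw : w ∈ {u | u <+: v ∨ u <+: w} := Or.inr List.prefix_rfl
  have hWn : [] ∈ {u | u <+: v ∨ u <+: w} := Or.inl List.nil_prefix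
  -- The cut at `-2`, needed to read off `f n`, is always present: `c + 2 ≥ 2` makes `w` nonempty,
  -- and its first digit is 0.
  have hW0 : [0] ∈ {u | u <+: v ∨ u <+: w} := by
    obtain ⟨a, w, rfl⟩ := List.exists_cons_of_ne_nil hw0
    obtain rfl : a = 0 := hw.2 a (by simp)
    exact Or.inr (by simp)
  have hWneg : ∀ u ∈ {u | u <+: v ∨ u <+: w}, IsNegZeckendorfWord u := fun u hu =>
    hu.elim hv.of_prefix hw.of_prefix
  have hWpre : ∀ u a, u ++ [a] ∈ {u | u <+: v ∨ u <+: w} → u ∈ {u | u <+: v ∨ u <+: w} :=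
    fun u a hu => hu.imp (List.prefix_append u [a]).trans (List.prefix_append u [a]).trans
  generalize {u | u <+: v ∨ u <+: w} = W at *
  have hne : (cutPoints W).Nonempty := ⟨_, goldenConj_add_one_mem_cutPoints hWn⟩
  have hpart := isPartitionOf_intervalsOf (cutPoints_subset W) (hfin.image _) hne
  obtain ⟨hPfin, hPcard⟩ := ncard_intervalsOf_le (cutPoints_subset W) (hfin.image _) hne
  rw [hP]
  have hex : ∀ n : ℕ, ∃ I ∈ intervalsOf (cutPoints W),
      Int.fract ((n : ℝ) * Real.goldenRatio) ∈ I := fun n => by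
    have : Int.fract ((n : ℝ) * Real.goldenRatio) ∈ ⋃₀ intervalsOf (cutPoints W) :=
      hpart.2.2 ▸ fract_mem_Ico _
    exact this
  have hins : ∀ I ∈ intervalsOf (cutPoints W), ∀ m n : ℕ,
      Int.fract ((m : ℝ) * Real.goldenRatio) ∈ I → Int.fract ((n : ℝ) * Real.goldenRatio) ∈ I →
      Unseparated W m n := fun I hI m n hm hn => (fract_mem_interval_iff hfin hWn hI hm).1 hn
  have happ : ∀ I ∈ intervalsOf (cutPoints W), ∀ (m n : ℕ) (a : Fin 2),
      Int.fract ((m : ℝ) * Real.goldenRatio) ∈ I → Int.fract ((n : ℝ) * Real.goldenRatio) ∈ I →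
      (a = 0 ∨ fibWord m = 0) → ∀ J ∈ intervalsOf (cutPoints W),
      Int.fract ((appendDigit m a : ℝ) * Real.goldenRatio) ∈ J →
      Int.fract ((appendDigit n a : ℝ) * Real.goldenRatio) ∈ J :=
    fun I hI m n a hm hn ha J hJ hmJ => (fract_mem_interval_iff hfin hWn hJ hmJ).2
      ((hins I hI m n hm hn).appendDigit hWneg hWpre hW0 ha)
  refine ⟨hpart, ?_, ?_, ?_⟩
  · intro I hI
    have hnext : ∀ a : Fin 2, ∃ J ∈ intervalsOf (cutPoints W), ∀ n : ℕ,
        Int.fract ((n : ℝ) * Real.goldenRatio) ∈ I → (a = 0 ∨ fibWord n = 0) →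
        Int.fract ((appendDigit n a : ℝ) * Real.goldenRatio) ∈ J := by
      intro a
      by_cases h : ∃ m : ℕ, Int.fract ((m : ℝ) * Real.goldenRatio) ∈ I ∧ (a = 0 ∨ fibWord m = 0)
      · obtain ⟨m, hm, ha⟩ := h
        obtain ⟨J, hJ, hmJ⟩ := hex (appendDigit m a)
        exact ⟨J, hJ, fun n hn _ => happ I hI m n a hm hn ha J hJ hmJ⟩
      -- With no admissible `n` in `I` any interval serves as target; `I` itself is a default value.
      · exact ⟨I, hI, fun n hn ha => (h ⟨n, hn, ha⟩).elim⟩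
    obtain ⟨I₀, h1, h2⟩ := hnext 0
    obtain ⟨I₁, h3, h4⟩ := hnext 1
    exact ⟨I₀, h1, I₁, h3, fun n hn => ⟨h2 n hn (Or.inl rfl), fun h => h4 n hn (by omega)⟩⟩
  · have : Finite (intervalsOf (cutPoints W)) := hPfin
    obtain ⟨M, h1, h2, h3⟩ := exists_dfao_generatesMsd (Q := intervalsOf (cutPoints W))
      (fun n I => Int.fract ((n : ℝ) * Real.goldenRatio) ∈ (I : Set ℝ))
      (fun i => fibWord (i + c)) (fun n => by simpa using hex n)
      (fun I m n a hm hn ha J hJ => happ I I.2 m n a hm hn ha J J.2 hJ)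
      (fun I m n hm hn => (hins I I.2 m n hm hn).fibWord_eq hW0)
      (fun I m n hm hn => (hins I I.2 m n hm hn).fibWord_add_eq hWv hv' hWw hw')
    exact ⟨M, by simpa using h1, h2, h3⟩
  · intro hc
    have hc' : (2 : ℝ) ≤ c := by exact_mod_cast hc
    have h1 : (Nat.card (intervalsOf (cutPoints W)) : ℝ) ≤ v.length + w.length + 2 := by
      exact_mod_cast hPcard.trans ((Set.ncard_image_le hfin).trans hcard)
    have hlog : ∀ s : ℕ, 1 ≤ s → s ≤ c + 2 → Real.log s ≤ 2 * Real.log c := fun s hs hsc => by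
      have h2 : (s : ℝ) ≤ c + 2 := by exact_mod_cast hsc
      have h3 : Real.log s ≤ Real.log ((c : ℝ) ^ 2) :=
        -- For `c ≥ 2`, `s ≤ c + 2 ≤ c ^ 2`.
        Real.log_le_log (by exact_mod_cast hs) (by nlinarith)
      rwa [Real.log_pow, Nat.cast_ofNat] at h3
    have hφ := Real.log_pos Real.one_lt_goldenRatio
    have h2 := Real.log_pos one_lt_two
    have hlen : ∀ l s : ℕ, Nat.fib (l + 1) ≤ s → 1 ≤ s → s ≤ c + 2 →
        (l : ℝ) ≤ 1 + 2 / Real.log Real.goldenRatio * Real.log c := fun l s hl hs hsc => by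
      have h3 := length_mul_log_goldenRatio_le hl
      have h4 := hlog s hs hsc
      rw [← mul_le_mul_iff_left₀ hφ]
      field_simp
      linarith
    have h3 := hlen _ _ hvl (by omega) (by omega)
    have h4 := hlen _ _ hwl (by omega) (by omega)
    have h5 : (4 : ℝ) ≤ 4 / Real.log 2 * Real.log c := by
      have := Real.log_le_log two_pos hc'
      rw [div_mul_eq_mul_div, le_div_iff₀ h2]
      linarith
    have h6 : 4 / Real.log Real.goldenRatio = 2 * (2 / Real.log Real.goldenRatio) := by ring
    rw [add_mul, h6]
    linarith
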